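/- Let $\beta:\mathbb{Z}^+\to\mathbb{Z}^+$ be a function and let $M$ be a matroid of rank $n$ whose girth $g$ (the smallest size of a circuit, with $g=\infty$ if $M$ has no circuits) satisfies $g \ge n-\beta(n)+1$. Let $\mathcal{B}=(B_1,\dots,B_n)$ be an $n$-tuple of pairwise disjoint bases of $M$, where the elements of $B_c$ are regarded as having colour $c$. A rainbow base is a base of $M$ containing exactly one element of each colour $1,\dots,n$; rainbow bases are disjoint if for each colour $c$ their representatives of colour $c$ are distinct; and $t(\mathcal{B})$ denotes the cardinality of a largest set of disjoint rainbow bases. If $n \ge 4\beta(n)^2+7\beta(n)+5$, then $$t(\mathcal{B}) \ge n-4\beta(n)^2-7\beta(n)-4.$$ -/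

import Mathlib

/-- The girth of a matroid: the smallest size of a circuit, and `⊤` if there are no circuits. -/
noncomputable def Matroid.girth {α : Type*} (M : Matroid α) : ℕ∞ :=
  ⨅ C : {C : Set α // M.IsCircuit C}, C.1.encard

/-- An `n`-tuple of bases of `M`; the elements of `B c` are thought of as coloured `c`. -/
def IsBaseSequence {α : Type*} {n : ℕ} (M : Matroid α) (B : Fin n → Set α) : Prop :=
  ∀ c, M.IsBase (B c)

/-- A base sequence is disjoint if its members are pairwise disjoint. -/
def IsDisjointBaseSequence {α : Type*} {n : ℕ} (M : Matroid α) (B : Fin n → Set α) : Prop :=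
  IsBaseSequence M B ∧ Pairwise fun c d => Disjoint (B c) (B d)

/-- The set of coloured elements `(x, c)` with `x ∈ B c`. -/
def colouredElements {α : Type*} {n : ℕ} (B : Fin n → Set α) : Set (α × Fin n) :=
  {p | p.1 ∈ B p.2}

/-- A rainbow base, as a set of coloured elements: it has exactly one element of each colour,
and its underlying elements are distinct and form a base of `M`. -/
def IsRainbowBase {α : Type*} {n : ℕ} (M : Matroid α) (B : Fin n → Set α)
    (S : Set (α × Fin n)) : Prop :=
  S ⊆ colouredElements B ∧ (∀ c : Fin n, ∃! x : α, (x, c) ∈ S) ∧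
    Set.InjOn Prod.fst S ∧ M.IsBase (Prod.fst '' S)

/-- A set of disjoint rainbow bases. As sets of coloured elements, two rainbow bases are
disjoint exactly when for every colour `c` their representatives of colour `c` are distinct. -/
def IsDisjointRainbowFamily {α : Type*} {n : ℕ} (M : Matroid α) (B : Fin n → Set α)
    (F : Set (Set (α × Fin n))) : Prop :=
  (∀ S ∈ F, IsRainbowBase M B S) ∧ F.Pairwise Disjoint

/-- `t_M(B)`: the largest cardinality of a set of disjoint rainbow bases. -/
noncomputable def rainbowNumber {α : Type*} {n : ℕ} (M : Matroid α) (B : Fin n → Set α) : ℕ∞ :=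
  ⨆ F : {F : Set (Set (α × Fin n)) // IsDisjointRainbowFamily M B F}, F.1.encard

open Finset Function

section RainbowPacking

variable {α : Type*} {M : Matroid α} {n b k : ℕ} {E : Finset α} {col : α → Fin n}

/-! Let b = β(n) and k = n - 4b² - 7b - 4. Among all families of k disjoint rainbow independent
sets, take one covering the most elements; every part is then a base (`IsMaxPacking.card_part_eq`).

Suppose a part S is deficient, and let u be an unused element of a colour missing from S. Maximality
puts u in the span of S, and by the girth its fundamental circuit has more than n - b elements.
Exchanging u for any other element of the circuit changes the missing colour without enlarging the
span. So all but fewer than b colours act as if missing (`IsMaxPacking.exists_good_colours`): their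
unused elements lie in the span of S, and their elements outside it can be moved into S, which
passes the deficiency to another part.

The spans of successive deficient parts are intersected. Each part has few good-coloured elements
outside a given span (`IsMaxPacking.card_outside_le`), so counting yields a fresh part whose span,
once deficient, cuts the intersection further (`IsSpanChain.exists_succ`). After b + 1 cuts the rank
is below n - b, yet the intersection still contains n - b unused elements, independent by the girth
(`IsSpanChain.le_eRk_add`). -/

lemma Matroid.Indep.mem_closure_sdiff_of_forall {S Y : Set α} {u : α} (hS : M.Indep S)
    (hu : u ∈ M.closure S) (h : ∀ y ∈ Y, u ∈ M.closure (S \ {y})) : u ∈ M.closure (S \ Y) := by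
  -- Closure commutes with intersections of subsets of an independent set; `S` itself keeps the
  -- family nonempty when `Y` is empty.
  have key := hS.closure_sInter_eq_biInter_closure_of_forall_subset
    (Js := insert S ((fun y => S \ {y}) '' Y)) ⟨S, Set.mem_insert _ _⟩ (by
      rintro J (rfl | ⟨y, -, rfl⟩)
      · exact subset_rfl
      · exact Set.sdiff_subset)
  have hmem : u ∈ M.closure (⋂₀ insert S ((fun y => S \ {y}) '' Y)) := by
    rw [key]
    simp only [Set.mem_iInter]
    rintro J (rfl | ⟨y, hy, rfl⟩)
    · exact hu
    · exact h y hy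
  refine M.closure_subset_closure ?_ hmem
  intro z hz
  rw [Set.mem_sInter] at hz
  refine ⟨hz S (Set.mem_insert _ _), fun hzY => ?_⟩
  exact (hz _ (Set.mem_insert_of_mem _ ⟨z, hzY, rfl⟩)).2 rfl

/-! ### Base colourings and packings -/

/-- A finite set `E` of elements of `M`, coloured so that every colour class is a base, all of
whose small subsets are independent. -/
structure IsBaseColouring (M : Matroid α) (n b : ℕ) (E : Finset α) (col : α → Fin n) : Prop where
  eRank_eq : M.eRank = n
  class_indep : ∀ c, M.Indep {e | e ∈ E ∧ col e = c}
  class_card : ∀ c, #{e ∈ E | col e = c} = n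
  indep_of_card_le : ∀ X ⊆ E, #X ≤ n - b → M.Indep (X : Set α)

/-- The elements of `E` assigned to the part `i`. -/
def part (E : Finset α) (a : α → Option (Fin k)) (i : Fin k) : Finset α :=
  {e ∈ E | a e = some i}

/-- The elements of `E` assigned to some part. -/
def used (E : Finset α) (a : α → Option (Fin k)) : Finset α :=
  {e ∈ E | a e ≠ none}

/-- An assignment whose parts are independent and rainbow. -/
def IsPacking (M : Matroid α) (E : Finset α) (col : α → Fin n) (a : α → Option (Fin k)) : Prop :=
  ∀ i, M.Indep (part E a i : Set α) ∧ Set.InjOn col (part E a i : Set α)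

/-- A packing using as many elements as possible. -/
def IsMaxPacking (M : Matroid α) (E : Finset α) (col : α → Fin n) (a : α → Option (Fin k)) :
    Prop :=
  IsPacking M E col a ∧ ∀ a' : α → Option (Fin k), IsPacking M E col a' →
    #(used E a') ≤ #(used E a)

lemma mem_part {a : α → Option (Fin k)} {i : Fin k} {e : α} :
    e ∈ part E a i ↔ e ∈ E ∧ a e = some i := by simp [part]

lemma mem_used {a : α → Option (Fin k)} {e : α} : e ∈ used E a ↔ e ∈ E ∧ a e ≠ none := by
  simp [used]

lemma exists_isMaxPacking (M : Matroid α) (E : Finset α) (col : α → Fin n) (k : ℕ) :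
    ∃ a : α → Option (Fin k), IsMaxPacking M E col a := by
  have hne : ∃ m, ∃ a : α → Option (Fin k), IsPacking M E col a ∧ #(used E a) = m := by
    refine ⟨_, fun _ => none, fun i => ?_, rfl⟩
    have : part E (fun _ => (none : Option (Fin k))) i = ∅ := by simp [part]
    simp [this]
  classical
  obtain ⟨m, hm⟩ := hne
  have hle : ∀ m, (∃ a : α → Option (Fin k), IsPacking M E col a ∧ #(used E a) = m) → m ≤ #E := by
    rintro m ⟨a, -, rfl⟩
    exact card_le_card (filter_subset _ _)
  obtain ⟨a, ha, hmax⟩ := Nat.findGreatest_spec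
    (P := fun m => ∃ a : α → Option (Fin k), IsPacking M E col a ∧ #(used E a) = m) (hle m hm) hm
  exact ⟨a, ha, fun a' ha' => hmax ▸ Nat.le_findGreatest (hle _ ⟨a', ha', rfl⟩) ⟨a', ha', rfl⟩⟩

section Update

variable [DecidableEq α] {a : α → Option (Fin k)}

lemma part_update_self {u : α} {i : Fin k} (hu : u ∈ E) :
    part E (update a u (some i)) i = insert u (part E a i) := by
  ext e
  by_cases h : e = u <;> simp [mem_part, h, hu]

lemma part_update_of_ne {u : α} {v : Option (Fin k)} {i : Fin k} (h : v ≠ some i) :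
    part E (update a u v) i = (part E a i).erase u := by
  ext e
  by_cases h' : e = u <;> simp [mem_part, h, h']

lemma used_update_some {u : α} {i : Fin k} (hu : u ∈ E) :
    used E (update a u (some i)) = insert u (used E a) := by
  ext e
  by_cases h : e = u <;> simp [mem_used, h, hu]

lemma used_update_none {u : α} : used E (update a u none) = (used E a).erase u := by
  ext e
  by_cases h : e = u <;> simp [mem_used, h]

end Update

lemma IsPacking.card_filter_col_le {a : α → Option (Fin k)} (ha : IsPacking M E col a) (i : Fin k)
    (c : Fin n) : #{e ∈ part E a i | col e = c} ≤ 1 := by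
  rw [card_le_one]
  intro x hx y hy
  rw [mem_filter] at hx hy
  exact (ha i).2 hx.1 hy.1 (hx.2.trans hy.2.symm)

/-- Each part misses at most one element of every colour class. -/
lemma IsPacking.card_unused_ge {a : α → Option (Fin k)} (ha : IsPacking M E col a)
    (hE : IsBaseColouring M n b E col) (c : Fin n) :
    n ≤ #{e ∈ E | col e = c ∧ a e = none} + k := by
  classical
  have hsub : {e ∈ E | col e = c} ⊆ {e ∈ E | col e = c ∧ a e = none} ∪
      (univ : Finset (Fin k)).biUnion fun i => {e ∈ part E a i | col e = c} := by
    intro e he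
    rw [mem_filter] at he
    simp only [mem_union, mem_filter, mem_biUnion, mem_univ, true_and, mem_part]
    rcases h : a e with _ | i
    · exact .inl ⟨he.1, he.2, rfl⟩
    · exact .inr ⟨i, ⟨he.1, rfl⟩, he.2⟩
  calc n = #{e ∈ E | col e = c} := (hE.class_card c).symm
    _ ≤ _ := card_le_card hsub
    _ ≤ _ := card_union_le _ _
    _ ≤ _ := by
      gcongr
      calc _ ≤ ∑ i : Fin k, #{e ∈ part E a i | col e = c} := card_biUnion_le
        _ ≤ ∑ i : Fin k, 1 := sum_le_sum fun i _ => ha.card_filter_col_le i c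
        _ = k := by simp

lemma IsBaseColouring.mem_ground (hE : IsBaseColouring M n b E col) {e : α} (he : e ∈ E) :
    e ∈ M.E :=
  (hE.class_indep (col e)).subset_ground ⟨he, rfl⟩

lemma IsPacking.card_part_le {a : α → Option (Fin k)} (ha : IsPacking M E col a) (i : Fin k) :
    #(part E a i) ≤ n := by
  simpa using card_le_card_of_injOn col (fun _ _ => mem_univ _) (ha i).2

/-! ### Deficient parts and good colours -/

/-- In a maximum packing, an unused element whose colour is missing from a part is spanned by it. -/
lemma IsMaxPacking.mem_closure {a : α → Option (Fin k)} (ha : IsMaxPacking M E col a)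
    (hE : IsBaseColouring M n b E col) {i : Fin k} {u : α} (huE : u ∈ E) (hu : a u = none)
    (hc : ∀ x ∈ part E a i, col x ≠ col u) : u ∈ M.closure (part E a i : Set α) := by
  classical
  by_contra hcl
  have hup : ∀ j, u ∉ part E a j := fun j hj => by simp [mem_part, hu] at hj
  have hP : IsPacking M E col (update a u (some i)) := by
    intro j
    by_cases hj : j = i
    · subst hj
      rw [part_update_self huE, coe_insert]
      refine ⟨(ha.1 j).1.insert_indep_iff.2 (.inl ⟨hE.mem_ground huE, hcl⟩), ?_⟩
      rw [Set.injOn_insert (by simpa using hup j)]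
      refine ⟨(ha.1 j).2, ?_⟩
      rintro ⟨x, hx, hxu⟩
      exact hc x hx hxu
    · rw [part_update_of_ne (by simpa using fun h => hj h.symm), erase_eq_of_notMem (hup j)]
      exact ha.1 j
  have := ha.2 _ hP
  rw [used_update_some huE, card_insert_of_notMem (by simp [mem_used, hu])] at this
  omega

/-- The packing data needed to shift the deficiency of part `i` to another part
through an element of colour `d`. -/
def IsGoodColour (M : Matroid α) (E : Finset α) (col : α → Fin n) (a : α → Option (Fin k))
    (i : Fin k) (d : Fin n) : Prop :=
  (∀ v ∈ E, col v = d → a v = none → v ∈ M.closure (part E a i : Set α)) ∧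
  ∀ j, ∀ x ∈ part E a j, col x = d → x ∉ M.closure (part E a i : Set α) →
    ∃ (a' : α → Option (Fin k)) (W : Finset α), IsMaxPacking M E col a' ∧ #W ≤ 3 ∧
      (∀ e ∉ W, a' e = a e) ∧ (∀ l, l ≠ i → l ≠ j → part E a' l = part E a l) ∧
      (part E a' j : Set α) = (part E a j : Set α) \ {x}

/-- Moving an element into a part that misses its colour and does not span it. -/
lemma IsMaxPacking.move {a : α → Option (Fin k)} (ha : IsMaxPacking M E col a)
    (hE : IsBaseColouring M n b E col) [DecidableEq α] {i j : Fin k} {x : α}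
    (hx : x ∈ part E a j) (hcl : x ∉ M.closure (part E a i : Set α))
    (hc : ∀ y ∈ part E a i, col y ≠ col x) :
    IsMaxPacking M E col (update a x (some i)) := by
  have hxE := (mem_part.1 hx).1
  refine ⟨fun l => ?_, fun a' ha' => ?_⟩
  · by_cases hl : l = i
    · subst hl
      rw [part_update_self hxE, coe_insert]
      refine ⟨(ha.1 l).1.insert_indep_iff.2 (.inl ⟨hE.mem_ground hxE, hcl⟩), ?_⟩
      rw [Set.injOn_insert fun h => hc x h rfl]
      refine ⟨(ha.1 l).2, ?_⟩
      rintro ⟨y, hy, hyx⟩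
      exact hc y hy hyx
    · rw [part_update_of_ne (by simpa using fun h => hl h.symm)]
      have hsub : ((part E a l).erase x : Set α) ⊆ part E a l := by
        exact_mod_cast erase_subset _ _
      exact ⟨(ha.1 l).1.subset hsub, (ha.1 l).2.mono hsub⟩
  · rw [used_update_some hxE, insert_eq_of_mem (by simp [mem_used, hxE, (mem_part.1 hx).2])]
    exact ha.2 _ ha'

/-- Replacing an element of a part by an unused element of a colour missing from the part. -/
lemma IsMaxPacking.swap {a : α → Option (Fin k)} (ha : IsMaxPacking M E col a)
    (hE : IsBaseColouring M n b E col) [DecidableEq α] {i : Fin k} {u y : α}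
    (huE : u ∈ E) (hu : a u = none) (hc : ∀ x ∈ part E a i, col x ≠ col u)
    (hy : y ∈ part E a i) (huy : u ∉ M.closure ((part E a i : Set α) \ {y})) :
    IsMaxPacking M E col (update (update a y none) u (some i)) := by
  have huny : u ≠ y := fun h => hc y hy (by rw [h])
  refine ⟨fun l => ?_, fun a' ha' => ?_⟩
  · have hsub : ((part E a l).erase y : Set α) ⊆ part E a l := by
      exact_mod_cast erase_subset _ _
    by_cases hl : l = i
    · subst hl
      rw [part_update_self huE, part_update_of_ne (by simp), coe_insert]
      refine ⟨((ha.1 l).1.subset hsub).insert_indep_iff.2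
        (.inl ⟨hE.mem_ground huE, by simpa using huy⟩), ?_⟩
      rw [Set.injOn_insert fun h => hc u (hsub h) rfl]
      refine ⟨(ha.1 l).2.mono hsub, ?_⟩
      rintro ⟨z, hz, hzx⟩
      exact hc z (hsub hz) hzx
    · rw [part_update_of_ne (by simpa using fun h => hl h.symm), part_update_of_ne (by simp)]
      have hsub' : (((part E a l).erase y).erase u : Set α) ⊆ part E a l := by
        exact_mod_cast (erase_subset _ _).trans (erase_subset _ _)
      exact ⟨(ha.1 l).1.subset hsub', (ha.1 l).2.mono hsub'⟩
  · have hyu : y ∈ used E a := by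
      have := mem_part.1 hy
      simp [mem_used, this]
    rw [used_update_some huE, used_update_none, card_insert_of_notMem (by simp [mem_used, hu]),
      card_erase_add_one hyu]
    exact ha.2 _ ha'

/-- All but fewer than `b` colours are good for a deficient part of a maximum packing. -/
lemma IsMaxPacking.exists_good_colours {a : α → Option (Fin k)} (ha : IsMaxPacking M E col a)
    (hE : IsBaseColouring M n b E col) (hk : k < n) {i : Fin k} (hi : #(part E a i) < n) :
    ∃ D : Finset (Fin n), n + 1 ≤ #D + b ∧ ∀ d ∈ D, IsGoodColour M E col a i d := by
  classical
  set S := part E a i with hS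
  obtain ⟨c, hc⟩ : ∃ c, c ∉ S.image col := by
    by_contra! h
    have h1 : #(S.image col) = n := by
      rw [eq_univ_iff_forall.2 h]
      simp
    have := card_image_le (s := S) (f := col)
    omega
  have hcS : ∀ x ∈ S, col x ≠ c := fun x hx h => hc (mem_image.2 ⟨x, hx, h⟩)
  obtain ⟨u, hu⟩ : ({e ∈ E | col e = c ∧ a e = none} : Finset α).Nonempty := by
    rw [← card_pos]
    have := ha.1.card_unused_ge hE c
    omega
  obtain ⟨huE, rfl, hun⟩ := (mem_filter.1 hu)
  have hucl := ha.mem_closure hE huE hun hcS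
  have huS : u ∉ S := fun h => hcS u h rfl
  -- `X` is the fundamental circuit of `u` in `S`, without `u`.
  set X : Finset α := {x ∈ S | u ∉ M.closure ((S : Set α) \ {x})} with hX
  have hXS : X ⊆ S := filter_subset _ _
  have hSE : S ⊆ E := filter_subset _ _
  have huX : u ∉ X := fun h => huS (hXS h)
  have hclX : u ∈ M.closure (X : Set α) := by
    have := (ha.1 i).1.mem_closure_sdiff_of_forall (Y := {x | u ∈ M.closure ((S : Set α) \ {x})})
      hucl (fun y hy => hy)
    convert this using 2
    ext x
    simp only [hX, coe_filter, Set.mem_ofPred_eq, Set.mem_sdiff, mem_coe, hS]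
  have hcard : n + 1 ≤ #X + 1 + b := by
    by_contra! h
    have hind := hE.indep_of_card_le (insert u X)
      (insert_subset huE (hXS.trans hSE)) (by rw [card_insert_of_notMem huX]; omega)
    rw [coe_insert] at hind
    exact (((ha.1 i).1.subset (by exact_mod_cast hXS)).notMem_closure_iff_of_notMem
      (by simpa using huX) (hE.mem_ground huE)).2 hind hclX
  refine ⟨insert (col u) (X.image col), ?_, ?_⟩
  · rw [card_insert_of_notMem (fun h => hc (image_subset_image hXS h)),
      card_image_of_injOn ((ha.1 i).2.mono (by exact_mod_cast hXS))]
    exact hcard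
  intro d hd
  rw [mem_insert] at hd
  rcases hd with rfl | hd
  · refine ⟨fun v hv hvc hvn => ha.mem_closure hE hv hvn (hvc ▸ hcS), fun j x hx hxc hxcl => ?_⟩
    have hji : j ≠ i := by
      rintro rfl
      exact hxcl (M.mem_closure_of_mem hx (ha.1 j).1.subset_ground)
    refine ⟨update a x (some i), {x}, ha.move hE hx hxcl (hxc ▸ hcS), by simp, fun e he => ?_,
      fun l hli hlj => ?_, ?_⟩
    · exact update_of_ne (by simpa using he) _ _
    · rw [part_update_of_ne (by simpa using hli.symm), erase_eq_of_notMem]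
      intro hxl
      exact hlj (Option.some_injective _ ((mem_part.1 hxl).2.symm.trans (mem_part.1 hx).2))
    · rw [part_update_of_ne (by simpa using hji.symm), coe_erase]
  · obtain ⟨y, hy, rfl⟩ := mem_image.1 hd
    obtain ⟨hyS, huy⟩ := mem_filter.1 hy
    have hmax := ha.swap hE huE hun hcS hyS huy
    set a₁ := update (update a y none) u (some i) with ha₁
    have hpart : part E a₁ i = insert u (S.erase y) := by
      rw [ha₁, part_update_self huE, part_update_of_ne (by simp)]
    -- As `u` is in the span of `S`, whatever the exchanged part spans is already spanned by `S`.
    have hcl₁ : M.closure (part E a₁ i : Set α) ⊆ M.closure (S : Set α) := by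
      refine M.closure_subset_closure_of_subset_closure ?_
      rw [hpart, coe_insert, coe_erase]
      exact Set.insert_subset hucl (Set.sdiff_subset.trans
        (M.subset_closure _ (ha.1 i).1.subset_ground))
    have hmiss : ∀ z ∈ part E a₁ i, col z ≠ col y := by
      intro z hz hzy
      rw [hpart, mem_insert, mem_erase] at hz
      rcases hz with rfl | ⟨hne, hz⟩
      · exact hcS y hyS hzy.symm
      · exact hne ((ha.1 i).2 hz hyS hzy)
    have hyu : y ≠ u := fun h => huS (h ▸ hyS)
    have hpl : ∀ l, l ≠ i → part E a₁ l = part E a l := by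
      intro l hl
      rw [ha₁, part_update_of_ne (by simpa using hl.symm), part_update_of_ne (by simp),
        erase_eq_of_notMem, erase_eq_of_notMem]
      · exact fun h => hl (Option.some_injective _
          ((mem_part.1 h).2.symm.trans (mem_part.1 hyS).2))
      · intro h
        have := (mem_part.1 (mem_erase.1 h).2).2
        simp [hun] at this
    refine ⟨fun v hv hvc hvn => hcl₁ (hmax.mem_closure hE hv ?_ (hvc ▸ hmiss)),
      fun j x hx hxc hxcl => ?_⟩
    · have h1 : v ≠ u := by
        rintro rfl
        exact hcS y hyS hvc.symm
      have h2 : v ≠ y := by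
        rintro rfl
        have := (mem_part.1 hyS).2
        simp [hvn] at this
      rw [ha₁, update_of_ne h1, update_of_ne h2, hvn]
    have hji : j ≠ i := by
      rintro rfl
      exact hxcl (M.mem_closure_of_mem hx (ha.1 j).1.subset_ground)
    have hx₁ : x ∈ part E a₁ j := by rwa [hpl j hji]
    -- The exchange touches `u` and `y`, the move touches `x`: hence the bound 3.
    refine ⟨update a₁ x (some i), {x, u, y}, hmax.move hE hx₁ (fun h => hxcl (hcl₁ h))
      (hxc ▸ hmiss), card_le_three, fun e he => ?_, fun l hli hlj => ?_, ?_⟩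
    · simp only [mem_insert, mem_singleton, not_or] at he
      rw [update_of_ne he.1, ha₁, update_of_ne he.2.1, update_of_ne he.2.2]
    · rw [part_update_of_ne (by simpa using hli.symm), erase_eq_of_notMem, hpl l hli]
      intro hxl
      exact hlj (Option.some_injective _ ((mem_part.1 hxl).2.symm.trans (mem_part.1 hx₁).2))
    · rw [part_update_of_ne (by simpa using hji.symm), coe_erase, hpl j hji]

lemma card_part_lt_of_eq_sdiff {a a' : α → Option (Fin k)} (ha : IsPacking M E col a) {j : Fin k}
    {x : α} (hx : x ∈ part E a j) (h : (part E a' j : Set α) = (part E a j : Set α) \ {x}) :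
    #(part E a' j) < n := by
  classical
  have h' : part E a' j = (part E a j).erase x := by
    rw [← coe_inj, h, coe_erase]
  rw [h']
  exact (card_erase_lt_of_mem hx).trans_le (ha.card_part_le j)

/-- A part has at most `b` elements of good colour outside the span of a deficient part. -/
lemma IsMaxPacking.card_outside_le {a : α → Option (Fin k)} (ha : IsMaxPacking M E col a)
    (hE : IsBaseColouring M n b E col) (hb : 0 < b) (hk : k + 4 * b ^ 2 + 7 * b + 4 ≤ n)
    {i : Fin k} {D : Finset (Fin n)} (hD : ∀ d ∈ D, IsGoodColour M E col a i d)
    (F : Set α) (hF : F = M.closure (part E a i : Set α)) (p : α → Prop) [DecidablePred p]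
    (hp : ∀ x, p x → col x ∈ D ∧ x ∉ F) (j : Fin k) :
    #{x ∈ part E a j | p x} ≤ b := by
  classical
  by_contra! hlt
  obtain ⟨Z, hZ, hZc⟩ := exists_subset_card_eq (Nat.succ_le_of_lt hlt)
  have hZj : Z ⊆ part E a j := hZ.trans (filter_subset _ _)
  have hex : ∀ x : Z, ∃ (a' : α → Option (Fin k)) (W : Finset α) (D' : Finset (Fin n)),
      #W ≤ 3 ∧ (∀ e ∉ W, a' e = a e) ∧ n + 1 ≤ #D' + b ∧
      ∀ d ∈ D', ∀ v ∈ E, col v = d → a' v = none → v ∈ M.closure ((part E a j : Set α) \ {x.1}) := by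
    rintro ⟨x, hx⟩
    obtain ⟨hxj, hxp⟩ := mem_filter.1 (hZ hx)
    obtain ⟨hxD, hxF⟩ := hp x hxp
    obtain ⟨a', W, ha', hW, hWa, -, hj⟩ := (hD _ hxD).2 j x hxj rfl (hF ▸ hxF)
    obtain ⟨D', hD', hgood⟩ := ha'.exists_good_colours hE (by omega)
      (card_part_lt_of_eq_sdiff ha.1 hxj hj)
    exact ⟨a', W, D', hW, hWa, hD', fun d hd => hj ▸ (hgood d hd).1⟩
  choose a' W D' hW hWa hD' hgood using hex
  -- Each of the b + 1 packings excludes at most b colours, and (b + 1)b < n, so one colour is good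
  -- for all.
  obtain ⟨c, hc⟩ : ∃ c, c ∉ (univ : Finset Z).biUnion fun x => (D' x)ᶜ := by
    by_contra! h
    have h1 : n ≤ #((univ : Finset Z).biUnion fun x => (D' x)ᶜ) := by
      rw [eq_univ_iff_forall.2 h]
      simp
    have h2 : #((univ : Finset Z).biUnion fun x => (D' x)ᶜ) ≤ #(univ : Finset Z) * b := by
      refine card_biUnion_le_card_mul _ _ _ fun x _ => ?_
      rw [card_compl, Fintype.card_fin]
      have := hD' x
      omega
    rw [card_univ, Fintype.card_coe, hZc] at h2
    nlinarith
  have hWc : #((univ : Finset Z).biUnion W) ≤ (b + 1) * 3 := by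
    have := card_biUnion_le_card_mul (univ : Finset Z) W 3 fun x _ => hW x
    rwa [card_univ, Fintype.card_coe, hZc] at this
  have hU := ha.1.card_unused_ge hE c
  obtain ⟨v, hv, hvW⟩ := exists_mem_notMem_of_card_lt_card
    (s := (univ : Finset Z).biUnion W) (t := {e ∈ E | col e = c ∧ a e = none}) (by nlinarith)
  obtain ⟨hvE, hvc, hvn⟩ := mem_filter.1 hv
  have hvcl : ∀ x ∈ Z, v ∈ M.closure ((part E a j : Set α) \ {x}) := by
    intro x hx
    simp only [mem_biUnion, mem_univ, true_and, not_exists, mem_compl, not_not] at hc hvW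
    exact hgood ⟨x, hx⟩ c (hc _) v hvE hvc (by rw [hWa _ v (hvW _), hvn])
  obtain ⟨z, hz⟩ : Z.Nonempty := by
    rw [← card_pos]
    omega
  have hvZ := (ha.1 j).1.mem_closure_sdiff_of_forall (Y := Z)
    (M.closure_subset_closure Set.sdiff_subset (hvcl z hz)) hvcl
  rw [← coe_sdiff] at hvZ
  have hvj : v ∉ part E a j \ Z := by
    simp [mem_part, hvn]
  -- Deleting b + 1 elements and adding `v` leaves at most n - b, so the girth applies.
  have hind := hE.indep_of_card_le (insert v (part E a j \ Z))
    (insert_subset hvE (sdiff_subset.trans (filter_subset _ _))) (by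
      rw [card_insert_of_notMem hvj, card_sdiff_of_subset hZj]
      have := ha.1.card_part_le j
      have : b < n := by nlinarith
      omega)
  rw [coe_insert] at hind
  exact (((ha.1 j).1.subset (by exact_mod_cast sdiff_subset)).notMem_closure_iff_of_notMem
    (by simpa using hvj) (hE.mem_ground hvE)).2 hind hvZ

/-! ### Chains of spans of decreasing rank -/

/-- `G` is an intersection of `t` spans of deficient parts of maximum packings that differ from
`a₀` only in the elements of `W` and in the parts of `T`; the colours of `D` are good for all of
these packings. -/
structure IsSpanChain (M : Matroid α) (b : ℕ) (E : Finset α) (col : α → Fin n)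
    (a₀ : α → Option (Fin k)) (t : ℕ) (G : Set α) (T : Finset (Fin k)) (W : Finset α)
    (D : Finset (Fin n)) : Prop where
  ground : G ⊆ M.E
  card_parts : #T ≤ t
  card_elems : #W ≤ 3 * t
  card_colours : n + t ≤ #D + t * b
  eRk_add_le : M.eRk G + t ≤ n
  unused_mem : ∀ v ∈ E, col v ∈ D → a₀ v = none → v ∉ W → v ∈ G
  card_outside : ∀ l, ∀ Q ⊆ part E a₀ l, (∀ x ∈ Q, x ∉ W ∧ col x ∈ D ∧ x ∉ G) → #Q ≤ t * b
  witness : ∀ x ∈ E, col x ∈ D → x ∉ G → ∃ (a : α → Option (Fin k)) (i : Fin k),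
    IsMaxPacking M E col a ∧ i ∈ T ∧ IsGoodColour M E col a i (col x) ∧
      x ∉ M.closure (part E a i : Set α) ∧ (∀ e ∉ W, a e = a₀ e) ∧
      ∀ l ∉ T, part E a l = part E a₀ l

lemma isSpanChain_zero (hE : IsBaseColouring M n b E col) (a₀ : α → Option (Fin k)) :
    IsSpanChain M b E col a₀ 0 M.E ∅ ∅ univ where
  ground := subset_rfl
  card_parts := by simp
  card_elems := by simp
  card_colours := by simp
  eRk_add_le := by simp [hE.eRank_eq]
  unused_mem v hv _ _ _ := hE.mem_ground hv
  card_outside l Q hQ h := by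
    rw [Nat.zero_mul, Nat.le_zero, card_eq_zero, eq_empty_iff_forall_notMem]
    exact fun x hx => (h x hx).2.2 (hE.mem_ground (mem_part.1 (hQ hx)).1)
  witness x hx _ h := absurd (hE.mem_ground hx) h

/-- Each new span excludes at most b - 1 further colours and adds at most b outside elements per
part. -/
lemma IsSpanChain.extend [DecidableEq α] {a₀ a : α → Option (Fin k)} {t : ℕ}
    {G : Set α} {T T' : Finset (Fin k)} {W W' : Finset α} {D : Finset (Fin n)} (h : IsSpanChain M b E col a₀ t G T W D)
    (hE : IsBaseColouring M n b E col) (hb : 0 < b) (hk : k + 4 * b ^ 2 + 7 * b + 4 ≤ n)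
    (ha : IsMaxPacking M E col a) {i : Fin k} (hi : #(part E a i) < n)
    (hTT : T ⊆ T') (hT' : #T' ≤ t + 1) (hiT : i ∈ T') (hWW : W ⊆ W') (hW' : #W' ≤ 3 * (t + 1))
    (haW : ∀ e ∉ W', a e = a₀ e) (haT : ∀ l ∉ T', part E a l = part E a₀ l)
    (hG : ¬ G ⊆ M.closure (part E a i : Set α)) :
    ∃ D', IsSpanChain M b E col a₀ (t + 1) (G ∩ M.closure (part E a i : Set α)) T' W' D' := by
  classical
  obtain ⟨C, hC, hgood⟩ := ha.exists_good_colours hE (by nlinarith) hi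
  refine ⟨D ∩ C, Set.inter_subset_left.trans h.ground, hT', hW', ?_, ?_, ?_, ?_, ?_⟩
  · have h1 := h.card_colours
    have h2 := card_union_add_card_inter D C
    have h3 : #(D ∪ C) ≤ n := by simpa using card_le_univ (D ∪ C)
    rw [Nat.add_mul, Nat.one_mul]
    omega
  · have hle := h.eRk_add_le
    -- Equal finite ranks would give equal closures, putting `G` inside the new span.
    have hlt : M.eRk (G ∩ M.closure (part E a i : Set α)) + 1 ≤ M.eRk G := by
      refine Order.add_one_le_of_lt (lt_of_not_ge fun hge => hG fun x hx => ?_)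
      have hfin : M.IsRkFinite (G ∩ M.closure (part E a i : Set α)) := by
        rw [← Matroid.eRk_lt_top_iff]
        refine (M.eRk_le_eRank _).trans_lt ?_
        rw [hE.eRank_eq]
        exact ENat.natCast_lt_top n
      have := hfin.closure_eq_closure_of_subset_of_eRk_ge_eRk Set.inter_subset_left hge
      have hx' := M.mem_closure_of_mem hx h.ground
      rw [← this] at hx'
      exact M.closure_subset_closure_of_subset_closure Set.inter_subset_right hx'
    calc _ = (M.eRk (G ∩ M.closure (part E a i : Set α)) + 1) + t := by
          push_cast
          ring
      _ ≤ M.eRk G + t := by gcongr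
      _ ≤ n := hle
  · intro v hv hvD hvn hvW
    rw [mem_inter] at hvD
    exact ⟨h.unused_mem v hv hvD.1 hvn fun hw => hvW (hWW hw),
      (hgood _ hvD.2).1 v hv rfl (by rw [haW v hvW, hvn])⟩
  · intro l Q hQ hQ'
    set F := M.closure (part E a i : Set α) with hF
    have h1 := h.card_outside l {x ∈ Q | x ∉ G} ((filter_subset _ _).trans hQ) (by
      intro x hx
      obtain ⟨hxQ, hxG⟩ := mem_filter.1 hx
      obtain ⟨hxW, hxD, -⟩ := hQ' x hxQ
      exact ⟨fun hw => hxW (hWW hw), (mem_inter.1 hxD).1, hxG⟩)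
    have h2 := ha.card_outside_le hE hb hk (D := C) hgood F hF
      (fun x => col x ∈ C ∧ x ∉ F) (fun _ hx => hx) l
    have hsub : Q ⊆ {x ∈ Q | x ∉ G} ∪ {x ∈ part E a l | col x ∈ C ∧ x ∉ F} := by
      intro x hx
      obtain ⟨hxW, hxD, hxG⟩ := hQ' x hx
      rw [mem_union, mem_filter, mem_filter]
      by_cases hxG' : x ∈ G
      · obtain ⟨hxE, hxl⟩ := mem_part.1 (hQ hx)
        exact .inr ⟨mem_part.2 ⟨hxE, by rw [haW x hxW, hxl]⟩, (mem_inter.1 hxD).2,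
          fun hxF => hxG ⟨hxG', hxF⟩⟩
      · exact .inl ⟨hx, hxG'⟩
    have h3 := (card_le_card hsub).trans (card_union_le _ _)
    rw [Nat.add_mul, Nat.one_mul]
    omega
  · intro x hx hxD hxG
    rw [mem_inter] at hxD
    by_cases hxG' : x ∈ G
    · exact ⟨a, i, ha, hiT, hgood _ hxD.2, fun hF => hxG ⟨hxG', hF⟩, haW, haT⟩
    · obtain ⟨a', i', h1, h2, h3, h4, h5, h6⟩ := h.witness x hx hxD.1 hxG'
      exact ⟨a', i', h1, hTT h2, h3, h4, fun e he => h5 e fun hw => he (hWW hw),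
        fun l hl => h6 l fun hw => hl (hTT hw)⟩

/-- The unused elements of good colour force the intersection to have large rank. -/
lemma IsSpanChain.le_eRk_add {a₀ : α → Option (Fin k)} {t : ℕ} {G : Set α}
    {T : Finset (Fin k)} {W : Finset α} {D : Finset (Fin n)}
    (h : IsSpanChain M b E col a₀ t G T W D)
    (hE : IsBaseColouring M n b E col) (hb : 0 < b) (hk : k + 4 * b ^ 2 + 7 * b + 4 ≤ n)
    (ha₀ : IsPacking M E col a₀) (ht : t ≤ b + 1) :
    ((n - b : ℕ) : ℕ∞) ≤ M.eRk G := by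
  classical
  set U : Finset α := D.biUnion fun d => {e ∈ E | col e = d ∧ a₀ e = none} with hU
  -- Two unused elements per good colour suffice, since 2|D| - 3t ≥ n - b.
  have hUc : #D * 2 ≤ #U := by
    rw [hU, card_biUnion]
    · rw [← smul_eq_mul]
      refine card_nsmul_le_sum _ _ _ fun d _ => ?_
      have := ha₀.card_unused_ge hE d
      omega
    · intro d _ d' _ hdd
      refine Finset.disjoint_left.2 ?_
      intro x hx hx'
      exact hdd ((mem_filter.1 hx).2.1.symm.trans (mem_filter.1 hx').2.1)
  have hc := h.card_colours
  have hw := h.card_elems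
  have hsd := le_card_sdiff W U
  have htb : t * b ≤ t + (b + 1) * (b - 1) := by
    obtain ⟨b, rfl⟩ : ∃ b', b = b' + 1 := ⟨b - 1, by omega⟩
    simp only [Nat.add_sub_cancel]
    nlinarith
  have hbb : (b + 1) * (b - 1) ≤ b ^ 2 := by
    obtain ⟨b, rfl⟩ : ∃ b', b = b' + 1 := ⟨b - 1, by omega⟩
    simp only [Nat.add_sub_cancel]
    nlinarith
  obtain ⟨X, hX, hXc⟩ := exists_subset_card_eq (s := U \ W) (n := n - b) (by omega)
  have hXE : X ⊆ E := by
    intro x hx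
    obtain ⟨d, -, hd⟩ := mem_biUnion.1 (mem_sdiff.1 (hX hx)).1
    exact (mem_filter.1 hd).1
  have hXG : (X : Set α) ⊆ G := by
    intro x hx
    obtain ⟨hxU, hxW⟩ := mem_sdiff.1 (hX hx)
    obtain ⟨d, hdD, hd⟩ := mem_biUnion.1 hxU
    obtain ⟨hxE, rfl, hxn⟩ := mem_filter.1 hd
    exact h.unused_mem x hxE hdD hxn hxW
  have := (hE.indep_of_card_le X hXE hXc.le).encard_le_eRk_of_subset hXG
  rwa [Set.encard_coe_eq_coe_finsetCard, hXc] at this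

/-- Some part untouched by the chain has more than `n - r` elements outside `G`. -/
lemma IsSpanChain.exists_large_outside {a₀ : α → Option (Fin k)} {t : ℕ} {G : Set α}
    {T : Finset (Fin k)} {W : Finset α} {D : Finset (Fin n)}
    (h : IsSpanChain M b E col a₀ t G T W D)
    (hE : IsBaseColouring M n b E col) (hb : 0 < b) (hk : k + 4 * b ^ 2 + 7 * b + 4 ≤ n)
    (ht : 0 < t) (htb : t ≤ b) {r : ℕ} (hr : M.eRk G = r) :
    ∃ l ∉ T, ∃ Q ⊆ part E a₀ l, (∀ x ∈ Q, col x ∈ D ∧ x ∉ G) ∧ n < #Q + r := by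
  classical
  have hrt : r + t ≤ n := by
    have := h.eRk_add_le
    rw [hr] at this
    exact_mod_cast this
  obtain ⟨m, hm⟩ : ∃ m, n = r + m := ⟨n - r, by omega⟩
  by_contra! hcon
  set P : Finset α := D.biUnion fun d => {e ∈ E | col e = d ∧ e ∉ G} with hP
  -- A colour class is independent, so at most r of its n elements lie in `G`.
  have hPc : #D * m ≤ #P := by
    rw [hP, card_biUnion]
    · rw [← smul_eq_mul]
      refine card_nsmul_le_sum _ _ _ fun d _ => ?_
      have h1 : #{e ∈ E | col e = d ∧ e ∈ G} ≤ r := by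
        have hsub : (({e ∈ E | col e = d ∧ e ∈ G} : Finset α) : Set α) ⊆ G :=
          fun x hx => (mem_filter.1 hx).2.2
        have := ((hE.class_indep d).subset (J := {e | e ∈ E ∧ col e = d})
          (I := (({e ∈ E | col e = d ∧ e ∈ G} : Finset α) : Set α)) (fun x hx =>
            ⟨(mem_filter.1 hx).1, (mem_filter.1 hx).2.1⟩)).encard_le_eRk_of_subset hsub
        rw [hr, Set.encard_coe_eq_coe_finsetCard] at this
        exact_mod_cast this
      have h2 := card_filter_add_card_filter_not (s := {e ∈ E | col e = d}) (fun e => e ∈ G)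
      rw [filter_filter, filter_filter, hE.class_card d] at h2
      omega
    · intro d _ d' _ hdd
      refine Finset.disjoint_left.2 ?_
      intro x hx hx'
      exact hdd ((mem_filter.1 hx).2.1.symm.trans (mem_filter.1 hx').2.1)
  set Q : Fin k → Finset α := fun l => {x ∈ part E a₀ l | x ∉ W ∧ col x ∈ D ∧ x ∉ G} with hQ
  have hcover : P ⊆ W ∪ (T.biUnion Q ∪ (univ \ T).biUnion Q) := by
    intro x hx
    obtain ⟨d, hdD, hd⟩ := mem_biUnion.1 hx
    obtain ⟨hxE, rfl, hxG⟩ := mem_filter.1 hd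
    by_cases hxW : x ∈ W
    · exact mem_union_left _ hxW
    refine mem_union_right _ ?_
    rw [← union_biUnion, union_sdiff_of_subset (subset_univ _)]
    rcases hxa : a₀ x with _ | l
    · exact absurd (h.unused_mem x hxE hdD hxa hxW) hxG
    · exact mem_biUnion.2 ⟨l, mem_univ _, mem_filter.2 ⟨mem_part.2 ⟨hxE, hxa⟩, hxW, hdD, hxG⟩⟩
  have h1 : #(T.biUnion Q) ≤ t * (t * b) :=
    (card_biUnion_le_card_mul _ _ (t * b) fun l _ => h.card_outside l _ (filter_subset _ _)
      fun x hx => (mem_filter.1 hx).2).trans (Nat.mul_le_mul_right _ h.card_parts)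
  have h2 : #((univ \ T).biUnion Q) ≤ k * m := by
    refine (card_biUnion_le_card_mul _ _ m fun l hl => ?_).trans
      (Nat.mul_le_mul_right _ (by simpa using card_le_univ (univ \ T)))
    have := hcon l (mem_sdiff.1 hl).2 (Q l) (filter_subset _ _)
      fun x hx => (mem_filter.1 hx).2.2
    omega
  have h3 : #P ≤ 3 * t + (t * (t * b) + k * m) :=
    (card_le_card hcover).trans ((card_union_le _ _).trans (add_le_add h.card_elems
      ((card_union_le _ _).trans (add_le_add h1 h2))))
  have htm : t ≤ m := by omega
  -- Since t ≤ m, the error terms are absorbed into multiples of m, which then cancels.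
  have h4 : 3 * t + (t * (t * b) + k * m) ≤ (3 + t * b + k) * m := by
    have : t * (t * b) ≤ m * (t * b) := Nat.mul_le_mul_right _ htm
    nlinarith
  have h5 : #D ≤ 3 + t * b + k :=
    Nat.le_of_mul_le_mul_right (hPc.trans (h3.trans h4)) (by omega)
  have h6 := h.card_colours
  have h7 : t * b ≤ b ^ 2 := by nlinarith
  omega

/-- If deleting any single element of `Q` left `G` spanned by part `l`, deleting all of `Q` would
too, leaving fewer than r elements. The witness packing of a suitable `x` passes the deficiency to
`l`, still intact because `l ∉ T`. -/
lemma IsSpanChain.exists_succ {a₀ : α → Option (Fin k)} {t : ℕ} {G : Set α}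
    {T : Finset (Fin k)} {W : Finset α} {D : Finset (Fin n)}
    (h : IsSpanChain M b E col a₀ t G T W D)
    (hE : IsBaseColouring M n b E col) (hb : 0 < b) (hk : k + 4 * b ^ 2 + 7 * b + 4 ≤ n)
    (ha₀ : IsMaxPacking M E col a₀) (ht : 0 < t) (htb : t ≤ b) :
    ∃ G' T' W' D', IsSpanChain M b E col a₀ (t + 1) G' T' W' D' := by
  classical
  obtain ⟨r, hr⟩ : ∃ r : ℕ, M.eRk G = r := by
    refine ⟨_, (ENat.natCast_toNat (ne_top_of_le_ne_top ?_ (M.eRk_le_eRank G))).symm⟩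
    rw [hE.eRank_eq]
    exact ENat.natCast_ne_top n
  obtain ⟨l, hlT, Q, hQ, hQD, hQc⟩ := h.exists_large_outside hE hb hk ht htb hr
  have hrn : r ≤ n := by
    have := M.eRk_le_eRank G
    rw [hr, hE.eRank_eq] at this
    exact_mod_cast this
  obtain ⟨x, hxQ, hx⟩ : ∃ x ∈ Q, ¬ G ⊆ M.closure ((part E a₀ l : Set α) \ {x}) := by
    by_contra! hall
    obtain ⟨z, hz⟩ : Q.Nonempty := by
      rw [← card_pos]
      omega
    have hGQ : G ⊆ M.closure ((part E a₀ l \ Q : Finset α) : Set α) := by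
      intro v hv
      rw [coe_sdiff]
      exact (ha₀.1 l).1.mem_closure_sdiff_of_forall
        (M.closure_subset_closure Set.sdiff_subset (hall z hz hv)) fun y hy => hall y hy hv
    have h1 := (M.eRk_mono hGQ).trans_eq (M.eRk_closure_eq _)
    have h2 := h1.trans (M.eRk_le_encard _)
    rw [hr, Set.encard_coe_eq_coe_finsetCard, Nat.cast_le, card_sdiff_of_subset hQ] at h2
    have h3 := ha₀.1.card_part_le l
    have h4 := card_le_card hQ
    omega
  obtain ⟨hxD, hxG⟩ := hQD x hxQ
  obtain ⟨a, i, ha, hiT, hgood, hxcl, haW, haT⟩ :=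
    h.witness x (mem_part.1 (hQ hxQ)).1 hxD hxG
  have hal := haT l hlT
  have hxl : x ∈ part E a l := hal ▸ hQ hxQ
  obtain ⟨a', W', ha', hW', haW', hpart, hl⟩ := hgood.2 l x hxl rfl hxcl
  have hdef := card_part_lt_of_eq_sdiff ha.1 hxl hl
  rw [hal] at hl
  obtain ⟨D', hD'⟩ := h.extend hE hb hk ha' hdef (T' := insert l T) (W' := W ∪ W')
    (subset_insert _ _) ((card_insert_le _ _).trans (Nat.succ_le_succ h.card_parts))
    (mem_insert_self _ _) subset_union_left
    ((card_union_le _ _).trans (by have := h.card_elems; omega))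
    (fun e he => by
      rw [mem_union, not_or] at he
      rw [haW' e he.2, haW e he.1])
    (fun j hj => by
      rw [mem_insert, not_or] at hj
      rw [hpart j (fun hji => hj.2 (hji ▸ hiT)) hj.1, haT j hj.2])
    (by rwa [hl])
  exact ⟨_, _, _, _, hD'⟩

/-! ### Fullness of the parts and the theorem -/

/-- Every part of a maximum packing into few parts is full. -/
theorem IsMaxPacking.card_part_eq {a₀ : α → Option (Fin k)} (ha₀ : IsMaxPacking M E col a₀)
    (hE : IsBaseColouring M n b E col) (hb : 0 < b) (hk : k + 4 * b ^ 2 + 7 * b + 4 ≤ n)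
    (i : Fin k) : #(part E a₀ i) = n := by
  classical
  by_contra hne
  have hi : #(part E a₀ i) < n := lt_of_le_of_ne (ha₀.1.card_part_le i) hne
  have hchain : ∀ t ≤ b, ∃ G T W D, IsSpanChain M b E col a₀ (t + 1) G T W D := by
    intro t
    induction t with
    -- The first link is the deficient part itself: with t = 0 nothing lies outside `G`, so
    -- `IsSpanChain.exists_succ` cannot start.
    | zero =>
      intro _
      obtain ⟨D, hD⟩ := (isSpanChain_zero hE a₀).extend hE hb hk ha₀ hi (T' := {i}) (W' := ∅)
        (empty_subset _) (by simp) (by simp) subset_rfl (by simp) (fun _ _ => rfl)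
        (fun _ _ => rfl) (by
          intro hsub
          have h1 := (M.eRk_mono hsub).trans_eq (M.eRk_closure_eq _)
          have h2 := h1.trans (M.eRk_le_encard _)
          rw [M.eRk_ground, hE.eRank_eq, Set.encard_coe_eq_coe_finsetCard, Nat.cast_le] at h2
          omega)
      exact ⟨_, _, _, _, hD⟩
    | succ t ih =>
      intro ht
      obtain ⟨G, T, W, D, h⟩ := ih (by omega)
      exact h.exists_succ hE hb hk ha₀ (by omega) ht
  obtain ⟨G, T, W, D, h⟩ := hchain b le_rfl
  have h1 := h.le_eRk_add hE hb hk ha₀.1 le_rfl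
  have h2 : ((n - b : ℕ) : ℕ∞) + (b + 1 : ℕ) ≤ n :=
    (add_le_add_left h1 _).trans h.eRk_add_le
  have h3 : n - b + (b + 1) ≤ n := by exact_mod_cast h2
  omega

end RainbowPacking

theorem theorem1 {α : Type*} (M : Matroid α) (n : ℕ) (β : ℕ → ℕ)
    (hβ : ∀ m, 0 < m → 0 < β m)
    (hrank : M.eRank = n)
    (hgirth : ((n - β n + 1 : ℕ) : ℕ∞) ≤ M.girth)
    (B : Fin n → Set α) (hB : IsDisjointBaseSequence M B)
    (hn : 4 * β n ^ 2 + 7 * β n + 5 ≤ n) :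
    ((n - 4 * β n ^ 2 - 7 * β n - 4 : ℕ) : ℕ∞) ≤ rainbowNumber M B := by
  classical
  obtain ⟨hbase, hdisj⟩ := hB
  have hn0 : 0 < n := by omega
  have hcard : ∀ c, (B c).encard = n := fun c => (hbase c).encard_eq_eRank.trans hrank
  have hfin : ∀ c, (B c).Finite := fun c => Set.finite_of_encard_eq_coe (hcard c)
  set E : Finset α := univ.biUnion fun c => (hfin c).toFinset with hE
  have hmemE : ∀ x, x ∈ E ↔ ∃ c, x ∈ B c := fun x => by simp [hE]
  have hcol : ∀ x, ∃ c : Fin n, x ∈ E → x ∈ B c := by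
    intro x
    by_cases hx : x ∈ E
    · obtain ⟨c, hc⟩ := (hmemE x).1 hx
      exact ⟨c, fun _ => hc⟩
    -- Colour 0 is a junk value outside `E`.
    · exact ⟨⟨0, hn0⟩, fun h => absurd h hx⟩
  choose col hcol using hcol
  have hcolour : ∀ c x, x ∈ E ∧ col x = c ↔ x ∈ B c := by
    intro c x
    constructor
    · rintro ⟨hx, rfl⟩
      exact hcol x hx
    · intro hx
      have hxE := (hmemE x).2 ⟨c, hx⟩
      refine ⟨hxE, ?_⟩
      by_contra hne
      exact Set.disjoint_left.1 (hdisj hne) (hcol x hxE) hx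
  have hbc : IsBaseColouring M n (β n) E col := by
    refine ⟨hrank, fun c => ?_, fun c => ?_, fun X hX hXc => ?_⟩
    · exact (hbase c).indep.subset fun x hx => (hcolour c x).1 hx
    · have h1 : (({e ∈ E | col e = c} : Finset α) : Set α) = B c := by
        ext x
        rw [mem_coe, mem_filter, hcolour]
      have h2 := hcard c
      rw [← h1, Set.encard_coe_eq_coe_finsetCard] at h2
      exact_mod_cast h2
    · have hXM : (X : Set α) ⊆ M.E := fun x hx => (hbase _).subset_ground (hcol x (hX hx))
      rw [Matroid.indep_iff_not_dep]
      refine ⟨fun hdep => ?_, hXM⟩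
      obtain ⟨C, hCX, hC⟩ := hdep.exists_isCircuit_subset
      have h1 : M.girth ≤ C.encard := iInf_le_of_le ⟨C, hC⟩ le_rfl
      have h2 := (hgirth.trans h1).trans (Set.encard_le_encard hCX)
      rw [Set.encard_coe_eq_coe_finsetCard, Nat.cast_le] at h2
      omega
  set k := n - 4 * β n ^ 2 - 7 * β n - 4 with hk
  obtain ⟨a, ha⟩ := exists_isMaxPacking M E col k
  have hfull := ha.card_part_eq hbc (hβ n hn0) (by omega)
  set R : Fin k → Set (α × Fin n) := fun i => (fun x => (x, col x)) '' (part E a i : Set α) with hR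
  have hdisjR : ∀ i j, i ≠ j → Disjoint (R i) (R j) := by
    intro i j hij
    rw [Set.disjoint_left]
    rintro _ ⟨x, hx, rfl⟩ ⟨y, hy, hxy⟩
    obtain rfl : y = x := congrArg Prod.fst hxy
    exact hij (Option.some_injective _ ((mem_part.1 hx).2.symm.trans (mem_part.1 hy).2))
  -- Disjoint sets are distinct only if nonempty; this makes the k parts k members of the family.
  have hneR : ∀ i, (R i).Nonempty := by
    intro i
    refine Set.Nonempty.image _ ?_
    rw [coe_nonempty, ← card_pos, hfull]
    exact hn0
  have hinj : Function.Injective R := by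
    intro i j hij
    by_contra hne
    have := hdisjR i j hne
    rw [hij, disjoint_self] at this
    exact (hneR j).ne_empty this
  have hfam : IsDisjointRainbowFamily M B (Set.range R) := by
    refine ⟨?_, ?_⟩
    · rintro _ ⟨i, rfl⟩
      have hfst : Prod.fst '' R i = (part E a i : Set α) := by
        simp [hR, Set.image_image]
      refine ⟨?_, fun c => ?_, ?_, ?_⟩
      · rintro _ ⟨x, hx, rfl⟩
        exact hcol x (mem_part.1 hx).1
      · have himg : (part E a i).image col = univ := by
          rw [← card_eq_iff_eq_univ, card_image_of_injOn (ha.1 i).2, hfull, Fintype.card_fin]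
        obtain ⟨x, hx, rfl⟩ := mem_image.1 (himg ▸ mem_univ c)
        refine ⟨x, ⟨x, hx, rfl⟩, ?_⟩
        rintro y ⟨z, hz, hzy⟩
        obtain ⟨rfl, hzc⟩ := Prod.ext_iff.1 hzy
        exact (ha.1 i).2 hz hx hzc
      · rintro _ ⟨x, hx, rfl⟩ _ ⟨y, hy, rfl⟩ hxy
        obtain rfl : x = y := hxy
        rfl
      · rw [hfst]
        refine (ha.1 i).1.isBase_of_eRk_ge (finite_toSet _) ?_
        rw [(ha.1 i).1.eRk_eq_encard, Set.encard_coe_eq_coe_finsetCard, hfull, hrank]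
    · rintro _ ⟨i, rfl⟩ _ ⟨j, rfl⟩ hne
      exact hdisjR i j fun h => hne (h ▸ rfl)
  have hcardF : (Set.range R).encard = k := by
    rw [← Set.image_univ, hinj.encard_image, Set.encard_univ, ENat.card_eq_coe_fintype_card,
      Fintype.card_fin]
  exact hcardF ▸ le_iSup (fun F : {F : Set (Set (α × Fin n)) // IsDisjointRainbowFamily M B F} =>
    F.1.encard) ⟨_, hfam⟩
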